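/- Let $d\ge 1$, let $B_d$ be the closed unit ball of $\mathbb R^d$, and put $c_{\min}=\frac{3}{2\sqrt2}$. **Structures.** A randomized near neighbor structure for a distance function $D(q,x)$ ($q$ a query, $x$ a data point) draws a random seed, preprocesses a finite set $P$ of data points into a stored state (without seeing the query), and then answers a query with a point or with nothing. It is an *$(\rho,\kappa\rho)$-structure with success probability $p$* if for every finite $P$ and every query $q$ such that some $x\in P$ has $D(q,x)\le\rho$, with probability at least $p$ the answer is a point $x\in P$ with $D(q,x)\le\kappa\rho$. It is an *$(\rho,\kappa\rho)$-structure* if this holds for some constant $p>0$ that does not depend on $P$ and $q$. It is called an ALSH structure for general queries and an SLSH structure for set-queries. **Distances** (data points $x\in B_d$). * Euclidean ellipsoid distance with weights $w_1,\dots,w_d\ge0$: for a query $(p,(e_i)_{i=1}^d)$ with $p\in B_d$ and $(e_i)$ orthonormal, $\sum_{i=1}^d w_i\,(e_i^T(x-p))^2$. * Center Euclidean distance: for a set-query $Q=\{q_1,q_2\}\subset B_d$ (the case $q_1=q_2$ is allowed), $\max(\|x-q_1\|,\|x-q_2\|)$. **Construction.** Let $r>0$, $c>c_{\min}$, $0<\phi<1$,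 and $0<\delta\le\min\bigl(\tfrac12,\,1-\sqrt{c_{\min}/c}\bigr)\,\phi r$. For each $i=0,1,\dots,\lceil(1-\phi)r/\delta\rceil$ put $a'=i\delta$ and let $E_i$ be a randomized structure for queries $(p,(e_i))$ as above. Store the data points in all the $E_i$, with independent seeds. To answer a set-query $Q=\{q_1,q_2\}\subset B_d$ with $a:=\frac12\|q_1-q_2\|<(1-\phi)r$, choose a rigid transformation (an isometry of $\mathbb R^d$, with $R_0$ its linear part) $R$ that maps $\{q_1,q_2\}$ to $\{(a,0,\dots,0),(-a,0,\dots,0)\}$, and return the answer of $E_i$ with $i=\lceil a/\delta\rceil$ to the query with center $R^{-1}(0)=\frac{q_1+q_2}{2}$ and axes $R_0^{-1}e_1,\dots,R_0^{-1}e_d$, where $(e_i)$ is the standard basis. (If $q_1\ne q_2$, the first axis is parallel to $q_1-q_2$.) **Theorem.** For all such $d,r,c,\phi,\delta$, all structures $E_i$ and all choices of the rigid transformations $R$ (one for each $Q$): 1. The parameters $r'_i=\frac{c}{c_{\min}}(r^2-(i\delta)^2)$, $c'=\frac{c}{c_{\min}}$ and weights $\bigl(\frac{r+i\delta}{r-i\delta},1,\dots,1\bigr)$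 are admissible for every $i$ in the above range: $r'_i>0$, $c'>1$, the weights are non-negative, and they are rational if $\delta/r$ is rational. 2. If every $E_i$ is an $(r'_i,c'r'_i)$-ALSH structure for the Euclidean ellipsoid distance with weights $\bigl(\frac{r+i\delta}{r-i\delta},1,\dots,1\bigr)$, then the structure constructed above is an $(r,cr)$-SLSH structure for the center Euclidean distance and set-queries $\{q_1,q_2\}\subset B_d$ of size $2$ with $\frac12\|q_1-q_2\|<(1-\phi)r$. 3. For every real $p$, if every $E_i$ has success probability $p$ in this sense, then so has the constructed structure. -/

import Mathlib

open MeasureTheory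

universe u v w z

namespace SetQueryLSH

noncomputable section

/-! ### Near neighbor structures -/

/-- A randomized data structure storing finite sets of data points from `X` and answering queries
from `Q`. A random seed `ω` is drawn once; the preprocessing phase `build` sees the seed and the
data points only, the query phase `query` sees the seed, the stored state and the query, and
returns a point or nothing. -/
structure NNStructure (X : Type u) (Q : Type v) where
  /-- random seeds -/
  Ω : Type w
  [mΩ : MeasurableSpace Ω]
  /-- the law of the random seed -/
  μ : Measure Ω
  [isProb : IsProbabilityMeasure μ]
  /-- what the preprocessing phase stores -/
  State : Type z
  build : Ω → Finset X → State
  query : Ω → State → Q → Option X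
  measurableSet_query : ∀ (P : Finset X) (q : Q) (x : X),
    MeasurableSet {ω | query ω (build ω P) q = some x}

attribute [instance] NNStructure.mΩ NNStructure.isProb

namespace NNStructure

variable {X Q : Type*}

/-- For every data set and every query `q`: if some data point is at distance at most `r` from `q`,
then with probability at least `p` the answer is a data point at distance at most `c * r`. -/
def SolvesWithProb (D : NNStructure X Q) (dist : Q → X → ℝ) (r c p : ℝ) : Prop :=
  ∀ (P : Finset X) (q : Q), (∃ x ∈ P, dist q x ≤ r) →
    p ≤ D.μ.real {ω | ∃ x ∈ P, D.query ω (D.build ω P) q = some x ∧ dist q x ≤ c * r}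

/-- `D` is an `(r, cr)`-structure for the (asymmetric) distance `dist`: it succeeds with constant
probability. For set-queries this is an `(r, cr)`-SLSH structure, for general queries an
`(r, cr)`-ALSH structure. -/
def IsStructureFor (D : NNStructure X Q) (dist : Q → X → ℝ) (r c : ℝ) : Prop :=
  ∃ p : ℝ, 0 < p ∧ D.SolvesWithProb dist r c p

end NNStructure

/-! ### The euclidean ellipsoid distance -/

/-- Euclidean space `ℝ^d`. -/
abbrev Space (d : ℕ) : Type := EuclideanSpace ℝ (Fin d)

/-- The (closed) unit ball `B_d`. -/
abbrev UnitBall (d : ℕ) : Type := Metric.closedBall (0 : Space d) 1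

/-- An ellipsoid query: a center in the unit ball and orthonormal axes. -/
structure EllipsoidQuery (d : ℕ) where
  center : UnitBall d
  axes : Fin d → Space d
  orthonormal : Orthonormal ℝ axes

/-- The euclidean ellipsoid distance `∑ i, w i * (e i ⬝ (x - p)) ^ 2` with weights `w`. -/
def ellipsoidDist {d : ℕ} (w : Fin d → ℝ) (q : EllipsoidQuery d) (x : UnitBall d) : ℝ :=
  ∑ i, w i * (inner ℝ (q.axes i) ((x : Space d) - q.center)) ^ 2

/-! ### Set-queries of size 2 and the center distance -/

/-- Half the distance of the two points of a set-query. -/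
def halfDist {d : ℕ} : Sym2 (UnitBall d) → ℝ :=
  Sym2.lift ⟨fun q₁ q₂ => ‖(q₁ : Space d) - q₂‖ / 2, fun q₁ q₂ => by simp only [norm_sub_rev]⟩

/-- The set-queries `{q₁, q₂}` in the unit ball (unordered, `q₁ = q₂` allowed) with
`‖q₁ - q₂‖ / 2 < (1 - φ) * r`. -/
def PairQuery (d : ℕ) (r φ : ℝ) : Type := {Q : Sym2 (UnitBall d) // halfDist Q < (1 - φ) * r}

/-- The center euclidean distance `max ‖x - q₁‖ ‖x - q₂‖` of `x` to the set-query `{q₁, q₂}`. -/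
def pairCenterDist {d : ℕ} (Q : Sym2 (UnitBall d)) (x : UnitBall d) : ℝ :=
  Sym2.lift ⟨fun q₁ q₂ : UnitBall d => max ‖(x : Space d) - q₁‖ ‖(x : Space d) - q₂‖,
    fun _ _ => max_comm _ _⟩ Q

/-- The center euclidean distance on the admitted set-queries. -/
def centerDist {d : ℕ} {r φ : ℝ} (Q : PairQuery d r φ) (x : UnitBall d) : ℝ :=
  pairCenterDist Q.1 x

/-! ### Moving a set-query to standard position -/

/-- A rigid transformation of `ℝ^d` moving the two points of `Q` to `(a, 0, …, 0)` and
`(-a, 0, …, 0)`, where `a` is half their distance. -/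
structure Alignment {d : ℕ} [NeZero d] (Q : Sym2 (UnitBall d)) where
  toIso : Space d ≃ᵃⁱ[ℝ] Space d
  map_eq : Q.map (fun q : UnitBall d => toIso (q : Space d)) =
    s(EuclideanSpace.single 0 (halfDist Q), EuclideanSpace.single 0 (-halfDist Q))

/-- Every set-query can be moved to standard position. -/
instance Alignment.instNonempty {d : ℕ} [NeZero d] (Q : Sym2 (UnitBall d)) :
    Nonempty (Alignment Q) := by
  induction Q with
  | _ q₁ q₂ =>
    set u : Space d := (1 / 2 : ℝ) • ((q₁ : Space d) - q₂) with hu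
    set v : Space d := EuclideanSpace.single 0 (‖(q₁ : Space d) - q₂‖ / 2) with hv
    have huv : ‖u‖ = ‖v‖ := by
      rw [hu, hv, norm_smul, PiLp.norm_single, Real.norm_of_nonneg (by positivity),
        Real.norm_of_nonneg (by positivity)]
      ring
    set L := (Submodule.span ℝ {u - v})ᗮ.reflection
    have hL : L u = v := Submodule.reflection_sub huv
    refine ⟨⟨(AffineIsometryEquiv.vaddConst ℝ (midpoint ℝ (q₁ : Space d) q₂)).symm.trans
      L.toAffineIsometryEquiv, ?_⟩⟩
    have h1 : (q₁ : Space d) - midpoint ℝ (q₁ : Space d) q₂ = u := by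
      rw [hu, midpoint_eq_smul_add, invOf_eq_inv]; module
    have h2 : (q₂ : Space d) - midpoint ℝ (q₁ : Space d) q₂ = -u := by
      rw [hu, midpoint_eq_smul_add, invOf_eq_inv]; module
    simp only [Sym2.map_mk, halfDist, Sym2.lift_mk, AffineIsometryEquiv.coe_trans,
      Function.comp_apply, AffineIsometryEquiv.coe_vaddConst_symm, vsub_eq_sub,
      LinearIsometryEquiv.coe_toAffineIsometryEquiv, h1, h2, map_neg, hL]
    congr 2
    ext i
    by_cases h : i = 0 <;> simp [hv, h]

/-- The preimage of the origin is the midpoint of the two query points, so it lies in the ball. -/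
theorem Alignment.symm_zero_mem {d : ℕ} [NeZero d] {Q : Sym2 (UnitBall d)} (R : Alignment Q) :
    R.toIso.symm 0 ∈ Metric.closedBall (0 : Space d) 1 := by
  obtain ⟨R, hR⟩ := R
  induction Q with
  | _ q₁ q₂ =>
    have key : R (midpoint ℝ (q₁ : Space d) q₂) = 0 := by
      rw [show R (midpoint ℝ (q₁ : Space d) q₂) = midpoint ℝ (R q₁) (R q₂) from
        R.toAffineEquiv.map_midpoint _ _, midpoint_eq_smul_add]
      have hs : R (q₁ : Space d) + R (q₂ : Space d) = 0 := by
        simp only [Sym2.map_mk, Sym2.eq_iff] at hR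
        rcases hR with ⟨h1, h2⟩ | ⟨h1, h2⟩ <;> rw [h1, h2] <;> ext i <;>
          by_cases h : i = 0 <;> simp [h]
      rw [hs, smul_zero]
    have h0 : R.symm 0 = midpoint ℝ (q₁ : Space d) q₂ :=
      R.toEquiv.symm_apply_eq.mpr key.symm
    change R.symm 0 ∈ _
    rw [h0]
    exact (convex_closedBall (0 : Space d) 1).midpoint_mem q₁.2 q₂.2

/-- The ellipsoid query of a set-query: the center is the preimage of the origin, the axes are the
preimages (under the linear part) of the standard basis vectors. -/
def Alignment.ellipsoidQuery {d : ℕ} [NeZero d] {Q : Sym2 (UnitBall d)} (R : Alignment Q) :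
    EllipsoidQuery d where
  center := ⟨R.toIso.symm 0, R.symm_zero_mem⟩
  axes := fun i => R.toIso.linearIsometryEquiv.symm (EuclideanSpace.single i 1)
  orthonormal :=
    (EuclideanSpace.orthonormal_single (𝕜 := ℝ) (ι := Fin d)).comp_linearIsometryEquiv
      R.toIso.linearIsometryEquiv.symm

/-! ### Quantization and the structure for the center distance -/

/-- The constant `c_min = 3 / (2 √2)`. -/
def cMin : ℝ := 3 / (2 * √2)

/-- The largest admitted step `min (1/2) (1 - √(c_min / c)) * φ * r` of the quantization. -/
def maxStep (r c φ : ℝ) : ℝ := min (1 / 2) (1 - √(cMin / c)) * φ * r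

/-- The grid consists of the values `i * δ` for `i = 0, …, gridTop r φ δ`. -/
def gridTop (r φ δ : ℝ) : ℕ := ⌈(1 - φ) * r / δ⌉₊

/-- The ellipsoid weights `((r + a') / (r - a'), 1, …, 1)`. -/
def gridWeights (d : ℕ) [NeZero d] (r a' : ℝ) : Fin d → ℝ :=
  fun j => if j = 0 then (r + a') / (r - a') else 1

/-- The inner radius `r' = (c / c_min) * (r ^ 2 - a' ^ 2)`. -/
def gridRadius (r c a' : ℝ) : ℝ := c / cMin * (r ^ 2 - a' ^ 2)

/-- The index `⌈a / δ⌉` of the grid value `a' = ⌈a / δ⌉ * δ` used for the set-query `Q`. -/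
def gridIndex {d : ℕ} {r φ δ : ℝ} (hδ : 0 < δ) (Q : PairQuery d r φ) :
    Fin (gridTop r φ δ + 1) :=
  ⟨⌈halfDist Q.1 / δ⌉₊,
    Nat.lt_succ_of_le (Nat.ceil_mono (div_le_div_of_nonneg_right Q.2.le hδ.le))⟩

/-- The structure for the center euclidean distance. Independently for every grid value `i * δ`
it stores the data points in the given structure `E i`; a set-query `Q` is answered by the single
structure with index `⌈a / δ⌉`, queried with the ellipsoid query of `Q`. -/
def centerStructure {d : ℕ} [NeZero d] {r φ δ : ℝ} (hδ : 0 < δ)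
    (E : Fin (gridTop r φ δ + 1) → NNStructure.{0, 0, u, v} (UnitBall d) (EllipsoidQuery d))
    (R : ∀ Q : PairQuery d r φ, Alignment Q.1) :
    NNStructure.{0, 0, u, v} (UnitBall d) (PairQuery d r φ) where
  Ω := ∀ i, (E i).Ω
  μ := Measure.pi fun i => (E i).μ
  State := ∀ i, (E i).State
  build := fun ω P i => (E i).build (ω i) P
  query := fun ω s Q =>
    (E (gridIndex hδ Q)).query (ω (gridIndex hδ Q)) (s (gridIndex hδ Q)) (R Q).ellipsoidQuery
  measurableSet_query := fun P Q x =>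
    ((E (gridIndex hδ Q)).measurableSet_query P (R Q).ellipsoidQuery x).preimage
      (measurable_pi_apply (gridIndex hδ Q))

end

end SetQueryLSH

open SetQueryLSH

/-! After the rigid motion a data point enters only through `t`, the absolute value of its first
coordinate, and `s`, its squared distance to the first axis. Center distance at most `ρ` then means
`(t + a)² + s ≤ ρ²`, while the ellipsoid distance is `w t² + s` with `w = (r + a') / (r - a')`.
Correctness thus reduces to two implications in real variables, for `a ≤ a' ≤ a + δ`: near points
stay near (`ellipsoid_le_of_center_le`, convexity in `t`), and accepted points are within `c r`
(`center_le_of_ellipsoid_le`, where `c_min² = 9/8` arises as a maximum over `a'`). Each query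
consults a single coordinate of the product seed, so its success probability carries over. -/

namespace SetQueryLSH

section Constants

lemma cMin_pos : 0 < cMin := by
  unfold cMin; positivity

lemma cMin_sq : cMin ^ 2 = 9 / 8 := by
  unfold cMin
  rw [div_pow, mul_pow, Real.sq_sqrt (by norm_num)]
  norm_num

end Constants

/-! ### Quantization of the half distance -/

section Grid

variable {r c φ δ : ℝ}

/-- A value `a'` less than one quantization step above `a` satisfies `k * (r - a) ≤ r - a'`
with `k = √(c_min / c)`. -/
lemma sqrt_mul_sub_le_sub {a a' : ℝ} (hr : 0 < r) (hc : cMin < c) (hφ0 : 0 < φ)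
    (hδ : δ ≤ maxStep r c φ) (ha : a ≤ (1 - φ) * r) (h : a' ≤ a + δ) :
    √(cMin / c) * (r - a) ≤ r - a' := by
  have hk : √(cMin / c) ≤ 1 :=
    Real.sqrt_le_one.mpr ((div_le_one (cMin_pos.trans hc)).mpr hc.le)
  have h1 : δ ≤ (1 - √(cMin / c)) * (φ * r) := by
    refine hδ.trans ?_
    rw [maxStep, mul_assoc]
    exact mul_le_mul_of_nonneg_right (min_le_right _ _) (by positivity)
  have h2 : (1 - √(cMin / c)) * (φ * r) ≤ (1 - √(cMin / c)) * (r - a) :=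
    mul_le_mul_of_nonneg_left (by linarith) (by linarith)
  linarith

/-- The top grid value may exceed `(1 - φ) r` by less than `δ`; the factor `1/2` in `maxStep` keeps
it below `r`. -/
lemma gridValue_lt (hr : 0 < r) (hφ0 : 0 < φ) (hφ1 : φ < 1) (hδ0 : 0 < δ)
    (hδ : δ ≤ maxStep r c φ) (i : Fin (gridTop r φ δ + 1)) : (i : ℝ) * δ < r := by
  have h0 : 0 ≤ (1 - φ) * r / δ := by
    have : 0 ≤ 1 - φ := by linarith
    positivity
  have h1 : (i : ℝ) ≤ gridTop r φ δ := by exact_mod_cast Nat.le_of_lt_succ i.2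
  have h2 : (i : ℝ) < (1 - φ) * r / δ + 1 := h1.trans_lt (Nat.ceil_lt_add_one h0)
  have h3 : (i : ℝ) * δ < (1 - φ) * r + δ := by
    calc (i : ℝ) * δ < ((1 - φ) * r / δ + 1) * δ := mul_lt_mul_of_pos_right h2 hδ0
      _ = (1 - φ) * r + δ := by field_simp
  have h4 : δ ≤ 1 / 2 * (φ * r) := by
    refine hδ.trans ?_
    rw [maxStep, mul_assoc]
    exact mul_le_mul_of_nonneg_right (min_le_left _ _) (by positivity)
  nlinarith [mul_pos hφ0 hr]

lemma gridRadius_pos {a' : ℝ} (hc : cMin < c) (ha0 : 0 ≤ a') (ha : a' < r) :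
    0 < gridRadius r c a' := by
  have h : 0 < r ^ 2 - a' ^ 2 := by nlinarith
  exact mul_pos (div_pos (cMin_pos.trans hc) cMin_pos) h

lemma gridWeights_nonneg (d : ℕ) [NeZero d] {a' : ℝ} (ha0 : 0 ≤ a') (ha : a' < r) (j : Fin d) :
    0 ≤ gridWeights d r a' j := by
  unfold gridWeights
  split_ifs
  · exact div_nonneg (by linarith) (by linarith)
  · exact zero_le_one

lemma gridWeights_rational (d : ℕ) [NeZero d] (hr : r ≠ 0) (n : ℕ) (h : ∃ ρ : ℚ, δ = ρ * r)
    (j : Fin d) : ∃ w : ℚ, gridWeights d r (n * δ) j = w := by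
  obtain ⟨ρ, rfl⟩ := h
  unfold gridWeights
  split_ifs
  · refine ⟨(1 + n * ρ) / (1 - n * ρ), ?_⟩
    push_cast
    rw [← mul_div_mul_right (1 + (n : ℝ) * ρ) (1 - n * ρ) hr]
    congr 1 <;> ring
  · exact ⟨1, by simp⟩

end Grid

/-! ### The two real inequalities -/

section Inequalities

variable {r c a a' t s : ℝ}

/-- Eliminating `s` bounds the left side by `(w - 1) t² - 2 a t + r² - a²`, which is convex in `t`
on `[0, r - a]`, so the end points suffice. -/
lemma ellipsoid_le_of_center_le (hc : cMin < c) (ha0 : 0 ≤ a) (haa' : a ≤ a') (ha' : a' < r)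
    (hk : √(cMin / c) * (r - a) ≤ r - a') (ht : 0 ≤ t) (hs : 0 ≤ s)
    (h : (t + a) ^ 2 + s ≤ r ^ 2) :
    (r + a') / (r - a') * t ^ 2 + s ≤ gridRadius r c a' := by
  have hc0 := cMin_pos.trans hc
  set k := √(cMin / c)
  have hk0 : 0 < k := Real.sqrt_pos.mpr (div_pos cMin_pos hc0)
  have hk2 : k ^ 2 = cMin / c := Real.sq_sqrt (div_pos cMin_pos hc0).le
  have hk1 : k ^ 2 ≤ 1 := by rw [hk2]; exact (div_le_one hc0).mpr hc.le
  have hC : c / cMin = (k ^ 2)⁻¹ := by rw [hk2, inv_div]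
  have hm' : 0 < r - a' := by linarith
  have hm : 0 < r - a := by linarith
  have htr : t ≤ r - a := by nlinarith
  set w := (r + a') / (r - a') with hw
  have hw1 : 1 ≤ w := by rw [hw, one_le_div hm']; linarith
  have hwm : w * (r - a') = r + a' := div_mul_cancel₀ _ hm'.ne'
  -- the left end point of the range of `t`
  have e0 : r ^ 2 - a ^ 2 ≤ (r ^ 2 - a' ^ 2) / k ^ 2 := by
    rw [le_div_iff₀ (by positivity)]
    have hkl : k ≤ 1 := by nlinarith
    nlinarith [mul_le_mul hk (show k * (r + a) ≤ r + a' by nlinarith)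
      (mul_nonneg hk0.le (by linarith)) hm'.le]
  -- the right end point
  have e1 : w * (r - a) ^ 2 ≤ (r ^ 2 - a' ^ 2) / k ^ 2 := by
    rw [le_div_iff₀ (by positivity)]
    have h1 : (k * (r - a)) ^ 2 ≤ (r - a') ^ 2 := pow_le_pow_left₀ (by positivity) hk 2
    have h2 : w * (r - a') ^ 2 = r ^ 2 - a' ^ 2 := by
      rw [pow_two, ← mul_assoc, hwm]; ring
    nlinarith [mul_le_mul_of_nonneg_left h1 (zero_le_one.trans hw1)]
  -- Chord bound `(r - a) f(t) ≤ (r - a - t) f(0) + t f(r - a)`, with `f(0) = r² - a²` and `f(r - a)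
  -- = w (r - a)²`.
  have hcv : (r - a) * ((w - 1) * t ^ 2 - 2 * a * t + r ^ 2 - a ^ 2)
      ≤ (r - a) * ((r ^ 2 - a' ^ 2) / k ^ 2) := by
    have h1 : (w - 1) * t * t * (r - a) ≤ (w - 1) * t * (r - a) * (r - a) := by
      have : 0 ≤ (w - 1) * t := mul_nonneg (by linarith) ht
      nlinarith [mul_le_mul_of_nonneg_left htr (mul_nonneg this hm.le)]
    nlinarith [mul_le_mul_of_nonneg_left e1 ht,
      mul_le_mul_of_nonneg_left e0 (show 0 ≤ r - a - t by linarith)]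
  have := le_of_mul_le_mul_left hcv hm
  rw [gridRadius, hC, inv_mul_eq_div]
  nlinarith

/-- Replacing `a` by `a'` only enlarges `(t + a)²`. The excess of `(t + a')² + s` over `w t² + s` is
`2 a' t - (w - 1) t² + a'²`, a concave parabola in `t`. -/
lemma center_le_of_ellipsoid_le (hr : 0 < r) (hc : cMin < c) (ha0 : 0 ≤ a) (haa' : a ≤ a')
    (ha' : a' < r) (ht : 0 ≤ t)
    (h : (r + a') / (r - a') * t ^ 2 + s ≤ c / cMin * gridRadius r c a') :
    (t + a) ^ 2 + s ≤ (c * r) ^ 2 := by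
  have hC : 1 < c / cMin := (one_lt_div cMin_pos).mpr hc
  have hcC : (c * r) ^ 2 = (c / cMin) ^ 2 * (9 / 8 * r ^ 2) := by
    have := cMin_pos.ne'
    rw [← cMin_sq]; field_simp
  rw [gridRadius] at h
  rw [hcC]
  set C := c / cMin
  have hC2 : 1 ≤ C ^ 2 := one_le_pow₀ hC.le
  have hm' : 0 < r - a' := by linarith
  set w := (r + a') / (r - a') with hw
  have hwm : w * (r - a') = r + a' := div_mul_cancel₀ _ hm'.ne'
  have hw1 : w - 1 = 2 * a' / (r - a') := by
    rw [hw]; field_simp; ring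
  -- As `w - 1 = 2 a' / (r - a')`, the maximum is at `t = (r - a') / 2`; `h2` completes the square.
  have h1 : 2 * a' * t - (w - 1) * t ^ 2 ≤ a' * (r - a') / 2 := by
    have h2 : a' * (r - a') / 2 - (2 * a' * t - (w - 1) * t ^ 2) =
        2 * a' / (r - a') * (t - (r - a') / 2) ^ 2 := by
      rw [hw1]; field_simp; ring
    have h3 : 0 ≤ 2 * a' / (r - a') * (t - (r - a') / 2) ^ 2 :=
      mul_nonneg (div_nonneg (by linarith) hm'.le) (sq_nonneg _)
    linarith
  have h2 : (t + a) ^ 2 ≤ (t + a') ^ 2 := pow_le_pow_left₀ (by positivity) (by linarith) 2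
  have h3 : 0 ≤ a' * (r - a') / 2 + a' ^ 2 := by
    have := mul_nonneg (ha0.trans haa') hm'.le
    positivity
  have h4 := mul_le_mul_of_nonneg_right hC2 h3
  -- What remains is `r² + a' r / 2 - a'² / 2 = 9/8 r² - (a' - r / 2)² / 2`, scaled by `C²`.
  have h5 := mul_nonneg (zero_le_one.trans hC2) (sq_nonneg (a' - r / 2))
  nlinarith

end Inequalities

/-! ### Both distances in standard position -/

section Geometry

variable {d : ℕ}

lemma halfDist_nonneg (Q : Sym2 (UnitBall d)) : 0 ≤ halfDist Q := by
  induction Q with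
  | _ q₁ q₂ => simp only [halfDist, Sym2.lift_mk]; positivity

variable [NeZero d]

lemma sum_mul_sq_eq_of_first (w : ℝ) (y : Space d) :
    ∑ j, (if j = 0 then w else 1) * y j ^ 2 = w * |y 0| ^ 2 + (‖y‖ ^ 2 - |y 0| ^ 2) := by
  have h : ∀ j : Fin d, (if j = 0 then w else 1) * y j ^ 2 =
      (if j = 0 then (w - 1) * y 0 ^ 2 else 0) + y j ^ 2 := by
    intro j
    split_ifs with hj
    · subst hj; ring
    · ring
  rw [Finset.sum_congr rfl fun j _ => h j, Finset.sum_add_distrib, EuclideanSpace.real_norm_sq_eq,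
    sq_abs]
  simp
  ring

lemma abs_apply_zero_sq_le (y : Space d) : |y 0| ^ 2 ≤ ‖y‖ ^ 2 := by
  have := PiLp.norm_apply_le y 0
  rw [Real.norm_eq_abs] at this
  gcongr

lemma norm_sub_single_sq (y : Space d) (a : ℝ) :
    ‖y - EuclideanSpace.single 0 a‖ ^ 2 = ‖y‖ ^ 2 - 2 * a * y 0 + a ^ 2 := by
  rw [norm_sub_sq_real, EuclideanSpace.inner_single_right, PiLp.norm_single, Real.norm_eq_abs,
    sq_abs]
  simp
  ring

/-- The farther of the two points lies on the opposite side of `y 0 = 0`, which turns the cross term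
into `+2 a |y 0|`. -/
lemma max_norm_sub_single_le_iff {a ρ : ℝ} (y : Space d) (ha : 0 ≤ a) (hρ : 0 ≤ ρ) :
    max ‖y - EuclideanSpace.single 0 a‖ ‖y - EuclideanSpace.single 0 (-a)‖ ≤ ρ ↔
      (|y 0| + a) ^ 2 + (‖y‖ ^ 2 - |y 0| ^ 2) ≤ ρ ^ 2 := by
  rw [max_le_iff, ← sq_le_sq₀ (norm_nonneg _) hρ, ← sq_le_sq₀ (norm_nonneg _) hρ,
    norm_sub_single_sq, norm_sub_single_sq]
  rcases abs_cases (y 0) with ⟨h, h0⟩ | ⟨h, h0⟩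
  · rw [h]
    exact ⟨fun H => by nlinarith, fun H => ⟨by nlinarith, by nlinarith⟩⟩
  · rw [h]
    exact ⟨fun H => by nlinarith, fun H => ⟨by nlinarith, by nlinarith⟩⟩

lemma Alignment.ellipsoidDist_gridWeights {Q : Sym2 (UnitBall d)} (R : Alignment Q) (r a' : ℝ)
    (x : UnitBall d) :
    ellipsoidDist (gridWeights d r a') R.ellipsoidQuery x =
      (r + a') / (r - a') * |R.toIso x 0| ^ 2 + (‖R.toIso x‖ ^ 2 - |R.toIso x 0| ^ 2) := by
  rw [← sum_mul_sq_eq_of_first]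
  refine Finset.sum_congr rfl fun j _ => ?_
  have h1 : R.toIso.linearIsometryEquiv ((x : Space d) - R.toIso.symm 0) = R.toIso x := by
    have := R.toIso.map_vsub (x : Space d) (R.toIso.symm 0)
    simpa using this
  have h2 : inner ℝ (R.ellipsoidQuery.axes j) ((x : Space d) - R.ellipsoidQuery.center) =
      R.toIso x j := by
    change inner ℝ (R.toIso.linearIsometryEquiv.symm (EuclideanSpace.single j 1))
      ((x : Space d) - R.toIso.symm 0) = _
    rw [← LinearIsometryEquiv.inner_map_map R.toIso.linearIsometryEquiv,
      LinearIsometryEquiv.apply_symm_apply, h1, EuclideanSpace.inner_single_left]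
    simp
  rw [h2, gridWeights]

lemma Alignment.pairCenterDist_eq {Q : Sym2 (UnitBall d)} (R : Alignment Q) (x : UnitBall d) :
    pairCenterDist Q x = max ‖R.toIso x - EuclideanSpace.single 0 (halfDist Q)‖
      ‖R.toIso x - EuclideanSpace.single 0 (-halfDist Q)‖ := by
  obtain ⟨R, hR⟩ := R
  induction Q with
  | _ q₁ q₂ =>
    have h : ∀ q : Space d, ‖(x : Space d) - q‖ = ‖R x - R q‖ := fun q => by
      rw [← dist_eq_norm, ← dist_eq_norm, R.dist_map]
    simp only [Sym2.map_mk, Sym2.eq_iff] at hR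
    simp only [pairCenterDist, Sym2.lift_mk, h]
    rcases hR with ⟨h1, h2⟩ | ⟨h1, h2⟩
    · rw [h1, h2]
    · rw [h1, h2, max_comm]

lemma Alignment.pairCenterDist_le_iff {Q : Sym2 (UnitBall d)} (R : Alignment Q) (x : UnitBall d)
    {ρ : ℝ} (hρ : 0 ≤ ρ) :
    pairCenterDist Q x ≤ ρ ↔
      (|R.toIso x 0| + halfDist Q) ^ 2 + (‖R.toIso x‖ ^ 2 - |R.toIso x 0| ^ 2) ≤ ρ ^ 2 := by
  rw [R.pairCenterDist_eq, max_norm_sub_single_le_iff _ (halfDist_nonneg Q) hρ]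

end Geometry

/-! ### Transfer of success probabilities -/

section Structures

variable {d : ℕ}

lemma NNStructure.SolvesWithProb.mono_prob {X Q : Type*} {D : NNStructure X Q} {dist : Q → X → ℝ}
    {r c p p' : ℝ} (h : D.SolvesWithProb dist r c p) (hp : p' ≤ p) :
    D.SolvesWithProb dist r c p' :=
  fun P q hq => hp.trans (h P q hq)

lemma NNStructure.measurableSet_success {X Q : Type*} (D : NNStructure X Q) (P : Finset X) (q : Q)
    (S : X → Prop) :
    MeasurableSet {ω | ∃ x ∈ P, D.query ω (D.build ω P) q = some x ∧ S x} := by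
  have h : {ω | ∃ x ∈ P, D.query ω (D.build ω P) q = some x ∧ S x} =
      ⋃ x ∈ P, ({ω | D.query ω (D.build ω P) q = some x} ∩ {_ω | S x}) := by
    ext ω; simp; grind
  rw [h]
  exact Finset.measurableSet_biUnion _ fun x _ =>
    (D.measurableSet_query P q x).inter (MeasurableSet.const _)

/-- A common success probability of the ellipsoid structures is also one of `centerStructure`. -/
lemma centerStructure_solvesWithProb [NeZero d] {r c φ δ : ℝ} (hr : 0 < r) (hc : cMin < c)
    (hφ0 : 0 < φ) (hφ1 : φ < 1) (hδ0 : 0 < δ) (hδ : δ ≤ maxStep r c φ)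
    (E : Fin (gridTop r φ δ + 1) → NNStructure.{0, 0, u, v} (UnitBall d) (EllipsoidQuery d))
    (R : ∀ Q : PairQuery d r φ, Alignment Q.1) {p : ℝ}
    (h : ∀ i, (E i).SolvesWithProb (ellipsoidDist (gridWeights d r (i * δ)))
        (gridRadius r c (i * δ)) (c / cMin) p) :
    (centerStructure hδ0 E R).SolvesWithProb centerDist r c p := by
  rintro P Q ⟨x, hxP, hx⟩
  set i := gridIndex hδ0 Q with hi
  have ha0 := halfDist_nonneg Q.1
  have hir := gridValue_lt hr hφ0 hφ1 hδ0 hδ i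
  have hival : ((i : ℕ) : ℝ) = ⌈halfDist Q.1 / δ⌉₊ := rfl
  have hlo : halfDist Q.1 ≤ (i : ℝ) * δ := by
    rw [hival, ← div_le_iff₀ hδ0]
    exact Nat.le_ceil _
  have hhi : (i : ℝ) * δ ≤ halfDist Q.1 + δ := by
    rw [hival, ← le_div_iff₀ hδ0, add_div, div_self hδ0.ne']
    exact (Nat.ceil_lt_add_one (div_nonneg ha0 hδ0.le)).le
  have hk := sqrt_mul_sub_le_sub hr hc hφ0 hδ Q.2.le hhi
  have near : ellipsoidDist (gridWeights d r (i * δ)) (R Q).ellipsoidQuery x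
      ≤ gridRadius r c (i * δ) := by
    rw [(R Q).ellipsoidDist_gridWeights]
    exact ellipsoid_le_of_center_le hc ha0 hlo hir hk (abs_nonneg _)
      (sub_nonneg.mpr (abs_apply_zero_sq_le _)) (((R Q).pairCenterDist_le_iff x hr.le).mp hx)
  refine (h i P (R Q).ellipsoidQuery ⟨x, hxP, near⟩).trans ?_
  -- Evaluation at `i` preserves measure, so the success event of `E i` keeps its probability when
  -- pulled back to the product.
  rw [← (measurePreserving_eval (fun i => (E i).μ) i).measureReal_preimage
    ((E i).measurableSet_success P _ _).nullMeasurableSet]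
  change _ ≤ (Measure.pi fun i => (E i).μ).real _
  refine measureReal_mono ?_
  rintro ω ⟨y, hyP, hy, hyd⟩
  refine ⟨y, hyP, hy, ?_⟩
  rw [(R Q).ellipsoidDist_gridWeights] at hyd
  exact ((R Q).pairCenterDist_le_iff y (mul_pos (cMin_pos.trans hc) hr).le).mpr
    (center_le_of_ellipsoid_le hr hc ha0 hlo hir (abs_nonneg _) hyd)

end Structures

end SetQueryLSH

theorem mainTheorem1 {d : ℕ} [NeZero d] {r c φ δ : ℝ} (hr : 0 < r) (hc : cMin < c)
    (hφ0 : 0 < φ) (hφ1 : φ < 1) (hδ0 : 0 < δ) (hδ : δ ≤ maxStep r c φ)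
    (E : Fin (gridTop r φ δ + 1) → NNStructure.{0, 0, u, v} (UnitBall d) (EllipsoidQuery d))
    (R : ∀ Q : PairQuery d r φ, Alignment Q.1) :
    -- the parameters of the ellipsoid structures are admissible
    (1 < c / cMin ∧ ∀ i : Fin (gridTop r φ δ + 1),
      0 < gridRadius r c (i * δ) ∧ (∀ j, 0 ≤ gridWeights d r (i * δ) j) ∧
      ((∃ ρ : ℚ, δ = ρ * r) → ∀ j, ∃ w : ℚ, gridWeights d r (i * δ) j = w)) ∧
    -- ellipsoid ALSH structures yield an SLSH structure for the center distance
    ((∀ i, (E i).IsStructureFor (ellipsoidDist (gridWeights d r (i * δ)))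
        (gridRadius r c (i * δ)) (c / cMin)) →
      (centerStructure hδ0 E R).IsStructureFor centerDist r c) ∧
    -- the success probability is preserved
    (∀ p : ℝ, (∀ i, (E i).SolvesWithProb (ellipsoidDist (gridWeights d r (i * δ)))
        (gridRadius r c (i * δ)) (c / cMin) p) →
      (centerStructure hδ0 E R).SolvesWithProb centerDist r c p) := by
  refine ⟨⟨(one_lt_div cMin_pos).mpr hc, fun i => ?_⟩, fun h => ?_, fun p h =>
    centerStructure_solvesWithProb hr hc hφ0 hφ1 hδ0 hδ E R h⟩
  · have h0 : 0 ≤ (i : ℝ) * δ := by positivity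
    have h1 := gridValue_lt hr hφ0 hφ1 hδ0 hδ i
    exact ⟨gridRadius_pos hc h0 h1, gridWeights_nonneg d h0 h1,
      gridWeights_rational d hr.ne' i⟩
  · choose p hp0 hp using h
    -- The grid is finite and nonempty, so the smallest success probability is attained and
    -- positive.
    obtain ⟨i₀, hi₀⟩ := Finite.exists_min p
    exact ⟨p i₀, hp0 i₀, centerStructure_solvesWithProb hr hc hφ0 hφ1 hδ0 hδ E R
      fun i => (hp i).mono_prob (hi₀ i)⟩
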